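/- Let $1\le p<\infty$ be real and write $\|x\|_p=(\sum_{i}|x_i|^p)^{1/p}$. The $L_p$-uniform distribution on the unit sphere of $\mathbb R^m$ ($m\ge 1$) is the law of $Z/\|Z\|_p$, where $Z$ is a random vector with Lebesgue density of the form $z\mapsto g(\|z\|_p)$ (this law does not depend on $g$). An $L_p$-norm spherical distribution on $\mathbb R^m$ is the law of $R\cdot U$ with a real random variable $R\ge 0$ independent of a random vector $U$ having the $L_p$-uniform distribution. A positive $L_p$-norm spherical copula of dimension $m$ is a probability distribution on $\mathbb R^m$ all of whose one-dimensional marginals are uniform on $(0,1)$ and which is the law of $(|V_1|,\dots,|V_m|)$ for some $V$ with an $L_p$-norm spherical distribution on $\mathbb R^m$. **Theorem.** Let $1\le d<n$ be integers and let $X=(X_1,\dots,X_d)$ be a random vector on a probability space $(\Omega,\mu)$ whose distribution is a positive $L_p$-norm spherical copula. Then $X$ can be extended to a random vector $(X_1,\dots,X_n)$ whose distribution is a positive $L_p$-norm spherical copula if and only if $n\le p+1$. Here "can be extended" means: there are a probability space $(\Omega',\mu')$, a measure-preserving map $\pi:\Omega'\to\Omega$ and a random vector $Y=(Y_1,\dots,Y_n)$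 on $\Omega'$ whose distribution is a positive $L_p$-norm spherical copula and which satisfies $Y_i=X_i\circ\pi$ for $i=1,\dots,d$. -/

import Mathlib

open MeasureTheory ProbabilityTheory
open scoped ENNReal NNReal

universe u

noncomputable section

namespace LpSpherical

/-- The `L_p`-norm `(∑ i, |x i| ^ p) ^ (1 / p)` of a vector, for real `p ≥ 1`. -/
def pNorm {n : ℕ} (p : ℝ) (x : Fin n → ℝ) : ℝ :=
  (∑ i, |x i| ^ p) ^ (1 / p)

/-- `ν` is an `L_p`-uniform distribution on the unit sphere of `ℝⁿ`: the law of
`X / ‖X‖_p`, where `X` is a random vector whose distribution has a density of the form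
`x ↦ g (‖x‖_p)` with respect to Lebesgue measure. (For `n ≥ 1` this law does not depend
on the choice of `g`.) -/
def IsLpUniform {n : ℕ} (p : ℝ) (ν : Measure (Fin n → ℝ)) : Prop :=
  ∃ g : ℝ → ℝ≥0, Measurable g ∧
    IsProbabilityMeasure
      ((volume : Measure (Fin n → ℝ)).withDensity (fun x => (g (pNorm p x) : ℝ≥0∞))) ∧
    ν = ((volume : Measure (Fin n → ℝ)).withDensity
      (fun x => (g (pNorm p x) : ℝ≥0∞))).map (fun x => (pNorm p x)⁻¹ • x)

/-- `P` is an `L_p`-norm spherical distribution on `ℝⁿ`: the law of `R • U` with an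
arbitrary real random variable `R ≥ 0` (of law `ρ`) independent of an `L_p`-uniformly
distributed vector `U` (of law `ν`). -/
def IsLpSpherical {n : ℕ} (p : ℝ) (P : Measure (Fin n → ℝ)) : Prop :=
  ∃ (ρ : Measure ℝ) (ν : Measure (Fin n → ℝ)),
    IsProbabilityMeasure ρ ∧ ρ (Set.Iio 0) = 0 ∧ IsLpUniform p ν ∧
      P = (ρ.prod ν).map (fun z => z.1 • z.2)

/-- `Q` is an `L_p`-norm spherical distribution on `[0,∞)ⁿ`: the law of
`(|X₁|, …, |Xₙ|)` where `X` has an `L_p`-norm spherical distribution on `ℝⁿ`. -/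
def IsPositiveLpSpherical {n : ℕ} (p : ℝ) (Q : Measure (Fin n → ℝ)) : Prop :=
  ∃ P : Measure (Fin n → ℝ), IsLpSpherical p P ∧ Q = P.map (fun x i => |x i|)

/-- All one-dimensional marginals of `Q` are uniform on `(0,1)`, i.e. `Q` is
(the distribution belonging to) a copula. -/
def HasUniformMarginals {n : ℕ} (Q : Measure (Fin n → ℝ)) : Prop :=
  ∀ i, Q.map (fun x => x i) = (volume : Measure ℝ).restrict (Set.Ioo 0 1)

/-- `Q` is a positive `L_p`-norm spherical copula. -/
def IsPositiveLpSphericalCopula {n : ℕ} (p : ℝ) (Q : Measure (Fin n → ℝ)) : Prop :=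
  HasUniformMarginals Q ∧ IsPositiveLpSpherical p Q

/-- The random vector `X = (X₁, …, X_d)` on `(Ω, μ)` can be extended to a random vector
`(X₁, …, Xₙ)` having a positive `L_p`-norm spherical copula: on some probability space
`(Ω', μ')` that extends `(Ω, μ)` through a measure-preserving map `π` there is a random
vector `Y` with values in `ℝⁿ` whose first `d` components are those of `X` and whose
law is such a copula. -/
def ExtendsToLpSphericalCopula {Ω : Type u} [MeasurableSpace Ω] (μ : Measure Ω)
    (p : ℝ) {d : ℕ} (X : Ω → Fin d → ℝ) (n : ℕ) (h : d ≤ n) : Prop :=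
  ∃ (Ω' : Type u) (_ : MeasurableSpace Ω') (μ' : Measure Ω') (π : Ω' → Ω)
    (Y : Ω' → Fin n → ℝ),
    IsProbabilityMeasure μ' ∧ MeasurePreserving π μ' μ ∧ Measurable Y ∧
      (∀ ω i, Y ω (Fin.castLE h i) = X (π ω) i) ∧
      IsPositiveLpSphericalCopula p (μ'.map Y)

end LpSpherical

end

/-! In each dimension there is at most one copula of this kind. The direction of a radially
distributed vector is independent of its norm and follows the normalized cone measure, so the law of
`U` is unique; and since `R |U_i|` is uniform, the law of `log R` is recovered by dividing
characteristic functions (`IsPositiveLpSphericalCopula.unique`).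

Necessity: `|U_i|` comes arbitrarily close to 1, so `R ≤ 1` almost surely and `P(|U_i| > 1 - ε) ≥
ε`. This probability is `O(ε ^ ((n - 1) / p))`, which forces `(n - 1) / p ≤ 1`
(`IsPositiveLpSphericalCopula.le_add_one`).

Sufficiency: take independent `Z_1, …, Z_n` with density proportional to `exp (-|z| ^ p)` and an
independent `W` with law Gamma(`1 - (n - 1) / p`), and put `Y_i = |Z_i| / (‖Z‖_p ^ p + W) ^ (1 /
p)`. Each `|Z_j| ^ p` is Gamma(`1 / p`), so `‖Z‖_p ^ p + W - |Z_i| ^ p` is a standard exponential,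
and this makes `Y_i` uniform. A subvector of `Y` has the same form, with the omitted terms absorbed
into `W`; by uniqueness the first `d` coordinates have the law of `X`. Disintegration then builds
`Y` over the given probability space. -/

namespace LpSpherical

/-! ### Polar decomposition: independence of norm and direction, cone measure. -/

section Polar

variable {m : ℕ} {p : ℝ}

theorem measurable_pNorm (p : ℝ) : Measurable (pNorm p : (Fin m → ℝ) → ℝ) := by
  unfold pNorm
  fun_prop

theorem pNorm_nonneg (p : ℝ) (x : Fin m → ℝ) : 0 ≤ pNorm p x := by
  unfold pNorm
  positivity

theorem pNorm_rpow (hp : 0 < p) (x : Fin m → ℝ) : pNorm p x ^ p = ∑ i, |x i| ^ p := by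
  unfold pNorm
  rw [← Real.rpow_mul (by positivity), one_div_mul_cancel hp.ne', Real.rpow_one]

theorem pNorm_smul (hp : 0 < p) {t : ℝ} (ht : 0 ≤ t) (x : Fin m → ℝ) :
    pNorm p (t • x) = t * pNorm p x := by
  unfold pNorm
  have : ∑ i, |(t • x) i| ^ p = t ^ p * ∑ i, |x i| ^ p := by
    rw [Finset.mul_sum]
    refine Finset.sum_congr rfl fun i _ => ?_
    rw [Pi.smul_apply, smul_eq_mul, abs_mul, abs_of_nonneg ht,
      Real.mul_rpow ht (abs_nonneg _)]
  rw [this, Real.mul_rpow (by positivity) (by positivity), ← Real.rpow_mul ht,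
    mul_one_div_cancel hp.ne', Real.rpow_one]

theorem abs_le_pNorm (hp : 0 < p) (x : Fin m → ℝ) (i : Fin m) : |x i| ≤ pNorm p x := by
  have h : |x i| ^ p ≤ pNorm p x ^ p := by
    rw [pNorm_rpow hp]
    exact Finset.single_le_sum (f := fun i => |x i| ^ p)
      (fun j _ => Real.rpow_nonneg (abs_nonneg _) _) (Finset.mem_univ i)
  exact (Real.rpow_le_rpow_iff (abs_nonneg _) (pNorm_nonneg _ _) hp).1 h

theorem pNorm_eq_zero (hp : 0 < p) {x : Fin m → ℝ} (h : pNorm p x = 0) : x = 0 := by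
  ext i
  have := abs_le_pNorm hp x i
  rw [h] at this
  exact abs_nonpos_iff.1 this

theorem pNorm_lt_one_iff (hp : 0 < p) (x : Fin m → ℝ) :
    pNorm p x < 1 ↔ ∑ i, |x i| ^ p < 1 := by
  rw [← pNorm_rpow hp, ← Real.rpow_lt_rpow_iff (pNorm_nonneg p x) zero_le_one hp, Real.one_rpow]

/-- The direction `x / ‖x‖_p` of a vector. -/
noncomputable def direction (p : ℝ) (x : Fin m → ℝ) : Fin m → ℝ := (pNorm p x)⁻¹ • x

theorem measurable_direction (p : ℝ) : Measurable (direction p : (Fin m → ℝ) → Fin m → ℝ) :=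
  (measurable_pNorm p).inv.smul measurable_id

theorem direction_smul (hp : 0 < p) {t : ℝ} (ht : 0 < t) (x : Fin m → ℝ) :
    direction p (t • x) = direction p x := by
  unfold direction
  rw [pNorm_smul hp ht.le, smul_smul, mul_inv_rev, mul_assoc, inv_mul_cancel₀ ht.ne', mul_one]

theorem pNorm_smul_direction (hp : 0 < p) (x : Fin m → ℝ) :
    pNorm p x • direction p x = x := by
  unfold direction
  by_cases h : pNorm p x = 0
  · rw [pNorm_eq_zero hp h]; simp
  · rw [smul_smul, mul_inv_cancel₀ h, one_smul]

theorem volume_pNorm_lt_one_ne_top (hp : 1 ≤ p) :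
    volume {x : Fin m → ℝ | pNorm p x < 1} ≠ ∞ := by
  simp_rw [pNorm_lt_one_iff (zero_lt_one.trans_le hp)]
  rw [volume_sum_rpow_lt_one _ hp]
  exact ENNReal.ofReal_ne_top

theorem volume_pNorm_lt_one_ne_zero (hp : 1 ≤ p) :
    volume {x : Fin m → ℝ | pNorm p x < 1} ≠ 0 := by
  have hp0 : 0 < p := zero_lt_one.trans_le hp
  simp_rw [pNorm_lt_one_iff hp0]
  rw [volume_sum_rpow_lt_one _ hp]
  have h1 : 0 < Real.Gamma (1 / p + 1) := Real.Gamma_pos_of_pos (by positivity)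
  have h2 : 0 < Real.Gamma (Fintype.card (Fin m) / p + 1) := Real.Gamma_pos_of_pos (by positivity)
  rw [Ne, ENNReal.ofReal_eq_zero, not_le]
  positivity

-- Dilation by `r` preserves directions and multiplies volume by `r ^ m`. At `r = 0` this needs `m ≠
-- 0`, because `0 ^ 0 = 1`.
open scoped Pointwise in
theorem volume_cone_pNorm_lt (hp : 0 < p) (hm : m ≠ 0) (A : Set (Fin m → ℝ)) {r : ℝ} (hr : 0 ≤ r) :
    volume {x : Fin m → ℝ | pNorm p x < r ∧ direction p x ∈ A} =
      ENNReal.ofReal (r ^ m) * volume {x : Fin m → ℝ | pNorm p x < 1 ∧ direction p x ∈ A} := by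
  rcases hr.eq_or_lt with rfl | hr
  · rw [zero_pow hm, ENNReal.ofReal_zero, zero_mul]
    convert measure_empty (μ := (volume : Measure (Fin m → ℝ)))
    ext x
    simp only [Set.mem_ofPred_eq, Set.mem_empty_iff_false, iff_false, not_and]
    intro h
    exact absurd (pNorm_nonneg p x) (not_le.2 h)
  have : {x : Fin m → ℝ | pNorm p x < r ∧ direction p x ∈ A} =
      r • {x : Fin m → ℝ | pNorm p x < 1 ∧ direction p x ∈ A} := by
    ext x
    rw [Set.mem_smul_set_iff_inv_smul_mem₀ hr.ne', Set.mem_ofPred_eq, Set.mem_ofPred_eq,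
      direction_smul hp (inv_pos.2 hr), pNorm_smul hp (inv_pos.2 hr).le, inv_mul_lt_iff₀ hr, mul_one]
  rw [this, Measure.addHaar_smul, Module.finrank_fin_fun, abs_of_nonneg (by positivity)]

/-- Shells `a ≤ ‖x‖_p < b` have volume proportional to `b ^ m - a ^ m` within any cone, so the
distributions of the norm on a cone and on the whole space are proportional. Cross-multiplying
avoids a division of measures. -/
theorem map_pNorm_restrict_cone (hp : 1 ≤ p) (hm : m ≠ 0) {A : Set (Fin m → ℝ)}
    (hA : MeasurableSet A) :
    volume {x : Fin m → ℝ | pNorm p x < 1} •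
        (volume.restrict (direction p ⁻¹' A)).map (pNorm p) =
      volume {x : Fin m → ℝ | pNorm p x < 1 ∧ direction p x ∈ A} •
        (volume : Measure (Fin m → ℝ)).map (pNorm p) := by
  have hp0 : 0 < p := zero_lt_one.trans_le hp
  set vB := volume {x : Fin m → ℝ | pNorm p x < 1}
  set vA := volume {x : Fin m → ℝ | pNorm p x < 1 ∧ direction p x ∈ A}
  have hvB : vB ≠ ∞ := volume_pNorm_lt_one_ne_top hp
  have hvA : vA ≠ ∞ := ne_top_of_le_ne_top hvB (measure_mono fun x hx => hx.1)
  -- The truncation `max · 0` covers intervals reaching below 0, where no norm lies.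
  have key : ∀ (S : Set (Fin m → ℝ)), MeasurableSet S → ∀ a b : ℝ, a < b →
      (volume.restrict (direction p ⁻¹' S)).map (pNorm p) (Set.Ico a b) =
        (ENNReal.ofReal (max b 0 ^ m) - ENNReal.ofReal (max a 0 ^ m)) *
          volume {x : Fin m → ℝ | pNorm p x < 1 ∧ direction p x ∈ S} := by
    intro S hS a b hab
    have hfin : volume {x : Fin m → ℝ | pNorm p x < 1 ∧ direction p x ∈ S} ≠ ∞ :=
      ne_top_of_le_ne_top hvB (measure_mono fun x hx => hx.1)
    rw [Measure.map_apply (measurable_pNorm p) measurableSet_Ico,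
      Measure.restrict_apply (measurable_pNorm p measurableSet_Ico)]
    have hset : pNorm p ⁻¹' Set.Ico a b ∩ direction p ⁻¹' S =
        {x : Fin m → ℝ | pNorm p x < max b 0 ∧ direction p x ∈ S} \
          {x : Fin m → ℝ | pNorm p x < max a 0 ∧ direction p x ∈ S} := by
      ext x
      have := pNorm_nonneg p x
      simp only [Set.mem_inter_iff, Set.mem_preimage, Set.mem_Ico, Set.mem_sdiff, Set.mem_ofPred_eq,
        lt_max_iff]
      grind
    rw [hset, measure_sdiff, volume_cone_pNorm_lt hp0 hm S (le_max_right _ _),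
      volume_cone_pNorm_lt hp0 hm S (le_max_right _ _), ENNReal.sub_mul]
    · exact fun _ _ => hfin
    · exact fun x hx => ⟨hx.1.trans_le (max_le_max_right 0 hab.le), hx.2⟩
    · exact ((measurableSet_lt (measurable_pNorm p) measurable_const).inter
        (measurable_direction p hS)).nullMeasurableSet
    · rw [volume_cone_pNorm_lt hp0 hm S (le_max_right _ _)]
      exact ENNReal.mul_ne_top ENNReal.ofReal_ne_top hfin
  have key' := key Set.univ MeasurableSet.univ
  simp only [Set.preimage_univ, Measure.restrict_univ, Set.mem_univ, and_true] at key'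
  refine Measure.ext_of_Ico' _ _ (fun a b hab => ?_) fun a b hab => ?_
  · rw [Measure.smul_apply, key A hA a b hab]
    exact ENNReal.mul_ne_top hvB (ENNReal.mul_ne_top (by finiteness) hvA)
  · rw [Measure.smul_apply, Measure.smul_apply, key A hA a b hab, key' a b hab, smul_eq_mul,
      smul_eq_mul]
    ring

/-- The measure with density `x ↦ g (‖x‖_p)`. -/
noncomputable abbrev radialMeasure (m : ℕ) (p : ℝ) (g : ℝ → ℝ≥0) : Measure (Fin m → ℝ) :=
  (volume : Measure (Fin m → ℝ)).withDensity (fun x => (g (pNorm p x) : ℝ≥0∞))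

/-- Integrating `g` over `S` against the two proportional distributions of the norm gives the
product form, that is, independence. -/
theorem radialMeasure_pNorm_direction (hp : 1 ≤ p) (hm : m ≠ 0) {g : ℝ → ℝ≥0} (hg : Measurable g)
    {A : Set (Fin m → ℝ)} (hA : MeasurableSet A) {S : Set ℝ} (hS : MeasurableSet S) :
    radialMeasure m p g {x | pNorm p x ∈ S ∧ direction p x ∈ A} =
      volume {x : Fin m → ℝ | pNorm p x < 1 ∧ direction p x ∈ A} /
        volume {x : Fin m → ℝ | pNorm p x < 1} * radialMeasure m p g {x | pNorm p x ∈ S} := by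
  have hN := measurable_pNorm (m := m) p
  have hD := measurable_direction (m := m) p
  have h := congrArg (fun μ : Measure ℝ => ∫⁻ r in S, (g r : ℝ≥0∞) ∂μ)
    (map_pNorm_restrict_cone hp hm hA)
  have hgm : Measurable fun r => (g r : ℝ≥0∞) := hg.coe_nnreal_ennreal
  simp only [Measure.restrict_smul, lintegral_smul_measure] at h
  rw [setLIntegral_map hS hgm hN, setLIntegral_map hS hgm hN,
    Measure.restrict_restrict (hN hS)] at h
  have hmeas : MeasurableSet {x : Fin m → ℝ | pNorm p x ∈ S ∧ direction p x ∈ A} :=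
    (hN hS).inter (hD hA)
  have hmeas' : MeasurableSet {x : Fin m → ℝ | pNorm p x ∈ S} := hN hS
  rw [radialMeasure, withDensity_apply _ hmeas, withDensity_apply _ hmeas',
    ← ENNReal.mul_div_right_comm]
  rw [ENNReal.eq_div_iff (volume_pNorm_lt_one_ne_zero hp) (volume_pNorm_lt_one_ne_top hp)]
  exact h

/-- The right side is free of `g`, whence the uniqueness of the `L_p`-uniform law. -/
theorem radialMeasure_direction (hp : 1 ≤ p) (hm : m ≠ 0) {g : ℝ → ℝ≥0} (hg : Measurable g)
    [IsProbabilityMeasure (radialMeasure m p g)] {A : Set (Fin m → ℝ)} (hA : MeasurableSet A) :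
    (radialMeasure m p g).map (direction p) A =
      volume {x : Fin m → ℝ | pNorm p x < 1 ∧ direction p x ∈ A} /
        volume {x : Fin m → ℝ | pNorm p x < 1} := by
  have h := radialMeasure_pNorm_direction hp hm hg hA MeasurableSet.univ
  simp only [Set.mem_univ, true_and, Set.ofPred_true, measure_univ, mul_one] at h
  rw [Measure.map_apply (measurable_direction p) hA]
  exact h

theorem map_direction_pNorm (hp : 1 ≤ p) (hm : m ≠ 0) {g : ℝ → ℝ≥0} (hg : Measurable g)
    [IsProbabilityMeasure (radialMeasure m p g)] :
    (radialMeasure m p g).map (fun x => (direction p x, pNorm p x)) =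
      ((radialMeasure m p g).map (direction p)).prod ((radialMeasure m p g).map (pNorm p)) := by
  have hN := measurable_pNorm (m := m) p
  have hD := measurable_direction (m := m) p
  have : IsProbabilityMeasure ((radialMeasure m p g).map (direction p)) :=
    Measure.isProbabilityMeasure_map hD.aemeasurable
  have : IsProbabilityMeasure ((radialMeasure m p g).map (pNorm p)) :=
    Measure.isProbabilityMeasure_map hN.aemeasurable
  symm
  refine Measure.prod_eq fun A S hA hS => ?_
  rw [Measure.map_apply (hD.prodMk hN) (hA.prod hS), radialMeasure_direction hp hm hg hA,
    Measure.map_apply hN hS]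
  refine Eq.trans ?_ (radialMeasure_pNorm_direction hp hm hg hA hS)
  congr 1
  ext x
  exact and_comm

theorem IsLpUniform.apply (hp : 1 ≤ p) (hm : m ≠ 0) {ν : Measure (Fin m → ℝ)}
    (hν : IsLpUniform p ν) {A : Set (Fin m → ℝ)} (hA : MeasurableSet A) :
    ν A = volume {x : Fin m → ℝ | pNorm p x < 1 ∧ direction p x ∈ A} /
        volume {x : Fin m → ℝ | pNorm p x < 1} := by
  obtain ⟨g, hg, hprob, rfl⟩ := hν
  exact radialMeasure_direction hp hm hg hA

theorem IsLpUniform.unique (hp : 1 ≤ p) (hm : m ≠ 0) {ν ν' : Measure (Fin m → ℝ)}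
    (hν : IsLpUniform p ν) (hν' : IsLpUniform p ν') : ν = ν' := by
  ext A hA
  rw [hν.apply hp hm hA, hν'.apply hp hm hA]

theorem IsLpUniform.isProbabilityMeasure {ν : Measure (Fin m → ℝ)} (hν : IsLpUniform p ν) :
    IsProbabilityMeasure ν := by
  obtain ⟨g, hg, hprob, rfl⟩ := hν
  exact Measure.isProbabilityMeasure_map (measurable_direction p).aemeasurable

end Polar

/-! ### Uniqueness of the radial law and of the copula. -/

section Uniqueness

/-- The uniform distribution on `(0,1)`. -/
noncomputable abbrev unif : Measure ℝ := (volume : Measure ℝ).restrict (Set.Ioo 0 1)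

instance : IsProbabilityMeasure unif := ⟨by simp [unif]⟩

/-- This is the Mellin transform `∫ x ^ (it)` over `(0,1)`. What matters later is that it never
vanishes. -/
theorem integral_exp_log_unif (t : ℝ) :
    ∫ x, Complex.exp (t * Real.log x * Complex.I) ∂unif = 1 / (1 + t * Complex.I) := by
  have h : ∫ x, Complex.exp (t * Real.log x * Complex.I) ∂unif =
      ∫ x in (0 : ℝ)..1, (x : ℂ) ^ (t * Complex.I) := by
    rw [intervalIntegral.integral_of_le zero_le_one, ← integral_Ioc_eq_integral_Ioo]
    refine setIntegral_congr_fun measurableSet_Ioc fun x hx => ?_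
    rw [Complex.cpow_def_of_ne_zero (by exact_mod_cast hx.1.ne'), ← Complex.ofReal_log hx.1.le]
    ring_nf
  have hre : ((t : ℂ) * Complex.I).re = 0 := by simp
  rw [h, integral_cpow (Or.inl (by rw [hre]; norm_num))]
  have hne : (t : ℂ) * Complex.I + 1 ≠ 0 := by
    intro h0
    have := congrArg Complex.re h0
    simp at this
  rw [Complex.ofReal_one, Complex.one_cpow, Complex.ofReal_zero, Complex.zero_cpow hne, sub_zero,
    add_comm]

theorem ae_mul_ne_zero_of_map_mul {ρ lam : Measure ℝ} [IsProbabilityMeasure ρ]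
    [IsProbabilityMeasure lam] (h : (ρ.prod lam).map (fun z => z.1 * z.2) = unif) :
    ∀ᵐ z ∂ρ.prod lam, z.1 * z.2 ≠ 0 := by
  have hm : Measurable fun z : ℝ × ℝ => z.1 * z.2 := by fun_prop
  have : ∀ᵐ x ∂unif, x ≠ 0 := Measure.ae_ne _ _
  rw [← h] at this
  exact ae_of_ae_map hm.aemeasurable this

theorem ae_fst_ne_zero_of_map_mul {ρ lam : Measure ℝ} [IsProbabilityMeasure ρ]
    [IsProbabilityMeasure lam] (h : (ρ.prod lam).map (fun z => z.1 * z.2) = unif) :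
    ∀ᵐ r ∂ρ, r ≠ 0 := by
  have h1 : ∀ᵐ z ∂ρ.prod lam, z.1 ≠ 0 := by
    filter_upwards [ae_mul_ne_zero_of_map_mul h] with z hz
    exact left_ne_zero_of_mul hz
  have h2 : ∀ᵐ r ∂(ρ.prod lam).map Prod.fst, r ≠ 0 :=
    (ae_map_iff measurable_fst.aemeasurable (measurableSet_singleton 0).compl).2 h1
  rwa [measurePreserving_fst.map_eq] at h2

theorem charFun_log_mul_charFun_log {ρ lam : Measure ℝ} [IsProbabilityMeasure ρ]
    [IsProbabilityMeasure lam] (h : (ρ.prod lam).map (fun z => z.1 * z.2) = unif) (t : ℝ) :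
    charFun (ρ.map Real.log) t * charFun (lam.map Real.log) t = 1 / (1 + t * Complex.I) := by
  have hl := Real.measurable_log
  rw [charFun_apply_real, charFun_apply_real, integral_map hl.aemeasurable (by fun_prop),
    integral_map hl.aemeasurable (by fun_prop), ← integral_prod_mul, ← integral_exp_log_unif, ← h,
    integral_map (by fun_prop) (by fun_prop)]
  refine integral_congr_ae ?_
  filter_upwards [ae_mul_ne_zero_of_map_mul h] with z hz
  rw [Real.log_mul (left_ne_zero_of_mul hz) (right_ne_zero_of_mul hz), ← Complex.exp_add]
  push_cast
  ring_nf

theorem ae_nonneg_of_measure_Iio {ρ : Measure ℝ} (h0 : ρ (Set.Iio 0) = 0) : ∀ᵐ r ∂ρ, 0 ≤ r := by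
  rw [ae_iff]
  simp only [not_le]
  exact h0

/-- `Real.log` forgets the sign and sends 0 to 0, so a law can be recovered from its logarithm only
on the positive half-line. -/
theorem map_exp_map_log {ρ : Measure ℝ} (h0 : ρ (Set.Iio 0) = 0) (h1 : ∀ᵐ r ∂ρ, r ≠ 0) :
    (ρ.map Real.log).map Real.exp = ρ := by
  rw [Measure.map_map Real.measurable_exp Real.measurable_log]
  conv_rhs => rw [← Measure.map_id (μ := ρ)]
  refine Measure.map_congr ?_
  filter_upwards [h1, ae_nonneg_of_measure_Iio h0] with r hr hr'
  exact Real.exp_log (lt_of_le_of_ne hr' hr.symm)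

theorem eq_of_map_mul_eq_unif {ρ ρ' lam : Measure ℝ} [IsProbabilityMeasure ρ]
    [IsProbabilityMeasure ρ'] [IsProbabilityMeasure lam]
    (hρ : ρ (Set.Iio 0) = 0) (hρ' : ρ' (Set.Iio 0) = 0)
    (h : (ρ.prod lam).map (fun z => z.1 * z.2) = unif)
    (h' : (ρ'.prod lam).map (fun z => z.1 * z.2) = unif) : ρ = ρ' := by
  have hlog : ρ.map Real.log = ρ'.map Real.log := by
    have := Measure.isProbabilityMeasure_map (μ := ρ) Real.measurable_log.aemeasurable
    have := Measure.isProbabilityMeasure_map (μ := ρ') Real.measurable_log.aemeasurable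
    refine Measure.ext_of_charFun (funext fun t => ?_)
    have e := charFun_log_mul_charFun_log h t
    have e' := charFun_log_mul_charFun_log h' t
    have hne : (1 : ℂ) + t * Complex.I ≠ 0 := by
      intro h0
      have := congrArg Complex.re h0
      simp at this
    -- The product of the two factors never vanishes, so the factor of `lam` can be cancelled.
    have hne' : charFun (lam.map Real.log) t ≠ 0 := by
      intro h0
      rw [h0, mul_zero] at e
      exact one_div_ne_zero hne e.symm
    exact mul_right_cancel₀ hne' (e.trans e'.symm)
  rw [← map_exp_map_log hρ (ae_fst_ne_zero_of_map_mul h), hlog,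
    map_exp_map_log hρ' (ae_fst_ne_zero_of_map_mul h')]

variable {m : ℕ} {p : ℝ}

/-- The law of `(|R U₁|, …, |R Uₘ|)` for independent `R`, `U` with laws `ρ`, `ν`. -/
noncomputable abbrev positiveScaled (ρ : Measure ℝ) (ν : Measure (Fin m → ℝ)) :
    Measure (Fin m → ℝ) :=
  ((ρ.prod ν).map fun z => z.1 • z.2).map fun x i => |x i|

theorem measurable_abs_pi : Measurable fun (x : Fin m → ℝ) i => |x i| := by fun_prop

theorem positiveScaled_eq (ρ : Measure ℝ) (ν : Measure (Fin m → ℝ)) :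
    positiveScaled ρ ν = (ρ.prod ν).map fun z i => |z.1 * z.2 i| := by
  rw [positiveScaled, Measure.map_map measurable_abs_pi (by fun_prop)]
  rfl

theorem map_eval_positiveScaled {ρ : Measure ℝ} {ν : Measure (Fin m → ℝ)}
    [IsProbabilityMeasure ρ] [IsProbabilityMeasure ν] (h0 : ρ (Set.Iio 0) = 0) (i : Fin m) :
    (positiveScaled ρ ν).map (fun x => x i) =
      (ρ.prod (ν.map fun u => |u i|)).map fun z => z.1 * z.2 := by
  have e : ρ.prod (ν.map fun u => |u i|) = (ρ.prod ν).map (Prod.map id fun u => |u i|) := by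
    rw [← Measure.map_prod_map ρ ν measurable_id (by fun_prop), Measure.map_id]
  rw [positiveScaled_eq, e, Measure.map_map (by fun_prop) (by fun_prop),
    Measure.map_map (by fun_prop) (by fun_prop)]
  refine Measure.map_congr ?_
  have h1 := ae_nonneg_of_measure_Iio h0
  have h2 : ∀ᵐ z ∂ρ.prod ν, 0 ≤ z.1 := by
    rw [← (measurePreserving_fst (μ := ρ) (ν := ν)).map_eq] at h1
    exact ae_of_ae_map measurable_fst.aemeasurable h1
  filter_upwards [h2] with z hz
  simp [abs_mul, abs_of_nonneg hz]

theorem IsPositiveLpSpherical.exists_positiveScaled {Q : Measure (Fin m → ℝ)}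
    (h : IsPositiveLpSpherical p Q) : ∃ (ρ : Measure ℝ) (ν : Measure (Fin m → ℝ)),
      IsProbabilityMeasure ρ ∧ ρ (Set.Iio 0) = 0 ∧ IsLpUniform p ν ∧ Q = positiveScaled ρ ν := by
  obtain ⟨P, ⟨ρ, ν, h1, h2, h3, rfl⟩, rfl⟩ := h
  exact ⟨ρ, ν, h1, h2, h3, rfl⟩

theorem IsPositiveLpSphericalCopula.unique (hp : 1 ≤ p) (hm : m ≠ 0) {Q Q' : Measure (Fin m → ℝ)}
    (h : IsPositiveLpSphericalCopula p Q) (h' : IsPositiveLpSphericalCopula p Q') : Q = Q' := by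
  obtain ⟨hu, hs⟩ := h
  obtain ⟨hu', hs'⟩ := h'
  obtain ⟨ρ, ν, h1, h2, h3, rfl⟩ := hs.exists_positiveScaled
  obtain ⟨ρ', ν', h1', h2', h3', rfl⟩ := hs'.exists_positiveScaled
  obtain rfl := h3.unique hp hm h3'
  have := h3.isProbabilityMeasure
  let i : Fin m := ⟨0, Nat.pos_of_ne_zero hm⟩
  have e := hu i
  have e' := hu' i
  rw [map_eval_positiveScaled h2] at e
  rw [map_eval_positiveScaled h2'] at e'
  have : IsProbabilityMeasure (ν.map fun u => |u i|) :=
    Measure.isProbabilityMeasure_map (Measurable.aemeasurable (by fun_prop))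
  rw [eq_of_map_mul_eq_unif h2 h2' e e']

end Uniqueness

/-! ### The dimension bound `m ≤ p + 1`. -/

section DimensionBound

variable {m : ℕ} {p : ℝ}

theorem continuous_pNorm (hp : 0 < p) : Continuous (pNorm p : (Fin m → ℝ) → ℝ) := by
  unfold pNorm
  refine Continuous.rpow_const ?_ fun _ => Or.inr (by positivity)
  exact continuous_finsetSum _ fun i _ =>
    (continuous_apply i).abs.rpow_const fun _ => Or.inr hp.le

theorem lt_abs_direction_iff (hp : 0 < p) {a : ℝ} (ha : 0 ≤ a) (x : Fin m → ℝ) (i : Fin m) :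
    a < |direction p x i| ↔ a * pNorm p x < |x i| := by
  rcases (pNorm_nonneg p x).eq_or_lt with h | h
  · have hx := pNorm_eq_zero hp h.symm
    subst hx
    rw [← h]
    simp [direction, ha]
  · rw [direction, Pi.smul_apply, smul_eq_mul, abs_mul, abs_inv, abs_of_pos h, lt_inv_mul_iff₀ h,
      mul_comm]

/-- Bernoulli gives `(1 - ε) ^ p ≥ 1 - p ε`, so a coordinate carrying almost the whole norm leaves
at most `p ε` of the sum for any other one. -/
theorem abs_rpow_le_of_lt_abs (hp : 1 ≤ p) {ε : ℝ} (hε : 0 ≤ ε) (hε1 : ε ≤ 1) {x : Fin m → ℝ}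
    (hx : pNorm p x ≤ 1) {i j : Fin m} (hij : j ≠ i) (h : (1 - ε) * pNorm p x ≤ |x i|) :
    |x j| ^ p ≤ p * ε := by
  have hp0 : 0 < p := zero_lt_one.trans_le hp
  have h0 := pNorm_nonneg p x
  have h1 : ((1 - ε) * pNorm p x) ^ p ≤ |x i| ^ p :=
    Real.rpow_le_rpow (mul_nonneg (by linarith) h0) h hp0.le
  rw [Real.mul_rpow (by linarith) h0] at h1
  have h2 : 1 + p * (-ε) ≤ (1 + -ε) ^ p := one_add_mul_self_le_rpow_one_add (by linarith) hp
  have h3 : |x i| ^ p + |x j| ^ p ≤ pNorm p x ^ p := by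
    rw [pNorm_rpow hp0]
    exact Finset.add_le_sum (f := fun i => |x i| ^ p)
      (fun k _ => Real.rpow_nonneg (abs_nonneg _) _) (Finset.mem_univ i) (Finset.mem_univ j) hij.symm
  have h4 : pNorm p x ^ p ≤ 1 := Real.rpow_le_one h0 hx hp0.le
  have h5 : 0 ≤ pNorm p x ^ p := Real.rpow_nonneg h0 _
  have h6 : (1 - p * ε) * pNorm p x ^ p ≤ (1 - ε) ^ p * pNorm p x ^ p := by
    refine mul_le_mul_of_nonneg_right ?_ h5
    rw [sub_eq_add_neg 1 ε]
    linarith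
  have h7 : p * ε * pNorm p x ^ p ≤ p * ε := mul_le_of_le_one_right (by positivity) h4
  linarith

theorem volume_abs_le (i : Fin m) {δ : ℝ} (hδ : 0 ≤ δ) :
    volume {x : Fin m → ℝ | |x i| ≤ 1 ∧ ∀ j ≠ i, |x j| ≤ δ} ≤
      ENNReal.ofReal (2 * (2 * δ) ^ (m - 1)) := by
  let b : Fin m → ℝ := Function.update (fun _ => δ) i 1
  have hsub : {x : Fin m → ℝ | |x i| ≤ 1 ∧ ∀ j ≠ i, |x j| ≤ δ} ⊆ Set.Icc (-b) b := by
    intro x hx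
    rw [Set.mem_Icc, Pi.le_def, Pi.le_def, ← forall_and]
    intro j
    rw [Pi.neg_apply, ← abs_le]
    by_cases hj : j = i
    · subst hj; simpa [b] using hx.1
    · simpa [b, hj] using hx.2 j hj
  refine (measure_mono hsub).trans ?_
  rw [Real.volume_Icc_pi]
  have hb : ∀ j, ENNReal.ofReal (b j - (-b) j) =
      Function.update (fun _ => ENNReal.ofReal (2 * δ)) i (ENNReal.ofReal 2) j := by
    intro j
    by_cases hj : j = i
    · subst hj; simp [b]; norm_num
    · simp [b, hj, two_mul]
  simp_rw [hb]
  rw [Finset.prod_update_of_mem (Finset.mem_univ i), Finset.prod_const,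
    Finset.card_sdiff_of_subset (by simp), Finset.card_univ, Fintype.card_fin,
    Finset.card_singleton, ← ENNReal.ofReal_pow (by positivity), ENNReal.ofReal_mul (by norm_num)]

/-- The cone truncated by the unit ball fits in a box with one side of length 2 and `m - 1` sides of
order `ε ^ (1 / p)`. -/
theorem IsLpUniform.measure_abs_gt_le (hp : 1 ≤ p) {ν : Measure (Fin m → ℝ)}
    (hν : IsLpUniform p ν) (i : Fin m) {ε : ℝ} (hε : 0 ≤ ε) (hε1 : ε ≤ 1) :
    ν {u | 1 - ε < |u i|} ≤ ENNReal.ofReal (2 * (2 * (p * ε) ^ (1 / p)) ^ (m - 1)) /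
      volume {x : Fin m → ℝ | pNorm p x < 1} := by
  have hp0 : 0 < p := zero_lt_one.trans_le hp
  have hm : m ≠ 0 := fun h => by subst h; exact i.elim0
  rw [hν.apply hp hm (measurableSet_lt (by fun_prop) (by fun_prop))]
  gcongr
  refine (measure_mono ?_).trans (volume_abs_le i (by positivity))
  rintro x ⟨hx, h⟩
  refine ⟨(abs_le_pNorm hp0 x i).trans hx.le, fun j hj => ?_⟩
  have := abs_rpow_le_of_lt_abs hp hε hε1 hx.le hj
    ((lt_abs_direction_iff hp0 (by linarith) x i).1 h).le
  rw [← Real.rpow_le_rpow_iff (abs_nonneg _) (by positivity) hp0, ← Real.rpow_mul (by positivity),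
    one_div_mul_cancel hp0.ne', Real.rpow_one]
  exact this

/-- The truncated cone is open and contains half of the `i`-th basis vector. -/
theorem IsLpUniform.measure_abs_gt_ne_zero (hp : 1 ≤ p) {ν : Measure (Fin m → ℝ)}
    (hν : IsLpUniform p ν) (i : Fin m) {a : ℝ} (ha : 0 ≤ a) (ha1 : a < 1) :
    ν {u | a < |u i|} ≠ 0 := by
  have hp0 : 0 < p := zero_lt_one.trans_le hp
  have hm : m ≠ 0 := fun h => by subst h; exact i.elim0
  rw [hν.apply hp hm (measurableSet_lt (by fun_prop) (by fun_prop))]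
  refine ENNReal.div_ne_zero.2 ⟨?_, volume_pNorm_lt_one_ne_top hp⟩
  have he : {x : Fin m → ℝ | pNorm p x < 1 ∧ direction p x ∈ {u : Fin m → ℝ | a < |u i|}} =
      {x : Fin m → ℝ | pNorm p x < 1 ∧ a * pNorm p x < |x i|} := by
    ext x
    exact and_congr_right fun _ => lt_abs_direction_iff hp0 ha x i
  rw [he]
  have hc := continuous_pNorm (m := m) hp0
  refine IsOpen.measure_ne_zero volume ((isOpen_lt hc continuous_const).inter
    (isOpen_lt (continuous_const.mul hc) (continuous_apply i).abs)) ⟨Pi.single i (1 / 2), ?_⟩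
  have hN : pNorm p (Pi.single i (1 / 2) : Fin m → ℝ) = 1 / 2 := by
    unfold pNorm
    rw [Finset.sum_eq_single i]
    · rw [Pi.single_eq_same, ← Real.rpow_mul (abs_nonneg _), mul_one_div_cancel hp0.ne',
        Real.rpow_one, abs_of_nonneg (by norm_num)]
    · intro j _ hj
      rw [Pi.single_eq_of_ne hj, abs_zero, Real.zero_rpow hp0.ne']
    · simp
  refine ⟨?_, ?_⟩
  · rw [hN]; norm_num
  · rw [hN, Pi.single_eq_same, abs_of_nonneg (by norm_num)]
    linarith

/-- A value `r > 1` would give a product above 1 whenever the second factor exceeds `r⁻¹ < 1`, an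
event of positive probability. -/
theorem ae_le_one_of_map_mul {ρ lam : Measure ℝ} [IsProbabilityMeasure ρ]
    [IsProbabilityMeasure lam] (h : (ρ.prod lam).map (fun z => z.1 * z.2) = unif)
    (hlam : ∀ a : ℝ, 0 ≤ a → a < 1 → lam (Set.Ioi a) ≠ 0) : ∀ᵐ r ∂ρ, r ≤ 1 := by
  have h1 : ∀ᵐ x ∂unif, x ≤ 1 := by
    filter_upwards [ae_restrict_mem measurableSet_Ioo] with x hx using hx.2.le
  rw [← h] at h1
  have h2 := Measure.ae_ae_of_ae_prod (ae_of_ae_map (by fun_prop) h1)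
  filter_upwards [h2] with r hr
  by_contra! hr1
  refine hlam r⁻¹ (by positivity) (inv_lt_one_of_one_lt₀ hr1) ?_
  rw [ae_iff] at hr
  refine measure_mono_null (fun s hs => ?_) hr
  have : 1 < r * s := by
    rwa [Set.mem_Ioi, inv_lt_iff_one_lt_mul₀ (by linarith), mul_comm] at hs
  simpa using this

/-- Multiplying by a factor in `[0,1]` cannot push a value above `1 - ε ≥ 0`, so `lam` has at least
the tail `ε` of the uniform law. -/
theorem ofReal_le_of_map_mul {ρ lam : Measure ℝ} [IsProbabilityMeasure ρ]
    [IsProbabilityMeasure lam] (h : (ρ.prod lam).map (fun z => z.1 * z.2) = unif)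
    (hρ : ∀ᵐ r ∂ρ, 0 ≤ r ∧ r ≤ 1) {ε : ℝ} (hε1 : ε ≤ 1) :
    ENNReal.ofReal ε ≤ lam (Set.Ioi (1 - ε)) := by
  have e : unif (Set.Ioi (1 - ε)) = ENNReal.ofReal ε := by
    rw [unif, Measure.restrict_apply measurableSet_Ioi, Set.inter_comm, Set.Ioo_inter_Ioi,
      max_eq_right (by linarith), Real.volume_Ioo]
    congr 1
    ring
  have hρ' : ∀ᵐ z ∂ρ.prod lam, 0 ≤ z.1 ∧ z.1 ≤ 1 := by
    rw [← (measurePreserving_fst (μ := ρ) (ν := lam)).map_eq] at hρ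
    exact ae_of_ae_map measurable_fst.aemeasurable hρ
  have e2 : lam (Set.Ioi (1 - ε)) = (ρ.prod lam) (Set.univ ×ˢ Set.Ioi (1 - ε)) := by
    rw [Measure.prod_prod, measure_univ, one_mul]
  rw [← e, ← h, e2, Measure.map_apply (by fun_prop) measurableSet_Ioi]
  refine measure_mono_ae ?_
  filter_upwards [hρ'] with z hz hz'
  refine ⟨Set.mem_univ _, ?_⟩
  have hlt : 1 - ε < z.1 * z.2 := hz'
  have h2 : 0 ≤ z.2 := by
    by_contra! h2
    nlinarith [mul_nonneg hz.1 (neg_nonneg.2 h2.le)]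
  have : z.1 * z.2 ≤ z.2 := mul_le_of_le_one_left h2 hz.2
  exact hlt.trans_le this

theorem exists_mul_rpow_lt (K : ℝ) {s : ℝ} (hs : 1 < s) :
    ∃ ε : ℝ, 0 < ε ∧ ε ≤ 1 ∧ K * ε ^ s < ε := by
  have h1 : 0 < s - 1 := by linarith
  have hK : 0 < 1 / (|K| + 1) := by positivity
  have hK1 : 1 / (|K| + 1) ≤ 1 := by
    rw [div_le_one (by positivity)]
    linarith [abs_nonneg K]
  -- Chosen so that `ε ^ (s - 1) = 1 / (|K| + 1)`, which turns the claim into `K / (|K| + 1) < 1`.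
  refine ⟨(1 / (|K| + 1)) ^ (1 / (s - 1)), by positivity,
    Real.rpow_le_one hK.le hK1 (by positivity), ?_⟩
  set ε := (1 / (|K| + 1)) ^ (1 / (s - 1)) with hεdef
  have hε : 0 < ε := by positivity
  have e : ε ^ s = ε * (1 / (|K| + 1)) := by
    have : ε ^ (s - 1) = 1 / (|K| + 1) := by
      rw [hεdef, ← Real.rpow_mul hK.le, one_div_mul_cancel h1.ne', Real.rpow_one]
    rw [← this, ← Real.rpow_one_add' hε.le (by linarith)]
    congr 1
    ring
  rw [e, ← mul_assoc, mul_comm K ε, mul_assoc]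
  refine mul_lt_of_lt_one_right hε ?_
  rw [mul_one_div, div_lt_one (by positivity)]
  linarith [le_abs_self K]

theorem IsPositiveLpSphericalCopula.le_add_one (hp : 1 ≤ p) (hm : m ≠ 0) {Q : Measure (Fin m → ℝ)}
    (h : IsPositiveLpSphericalCopula p Q) : (m : ℝ) ≤ p + 1 := by
  have hp0 : 0 < p := zero_lt_one.trans_le hp
  obtain ⟨hu, hs⟩ := h
  obtain ⟨ρ, ν, h1, h2, h3, rfl⟩ := hs.exists_positiveScaled
  have := h3.isProbabilityMeasure
  let i : Fin m := ⟨0, Nat.pos_of_ne_zero hm⟩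
  have e := hu i
  rw [map_eval_positiveScaled h2] at e
  have hmeas : Measurable fun u : Fin m → ℝ => |u i| := by fun_prop
  have : IsProbabilityMeasure (ν.map fun u => |u i|) :=
    Measure.isProbabilityMeasure_map hmeas.aemeasurable
  have hle := ae_le_one_of_map_mul e fun a ha ha1 => by
    rw [Measure.map_apply hmeas measurableSet_Ioi]
    exact h3.measure_abs_gt_ne_zero hp i ha ha1
  by_contra! hlt
  have hs1 : 1 < ((m : ℝ) - 1) / p := by
    rw [one_lt_div hp0]; linarith
  set V := volume {x : Fin m → ℝ | pNorm p x < 1} with hV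
  have hV0 : V ≠ 0 := volume_pNorm_lt_one_ne_zero hp
  have hVt : V ≠ ∞ := volume_pNorm_lt_one_ne_top hp
  -- The constant is the bound of `measure_abs_gt_le` with `ε ^ ((m - 1) / p)` factored out.
  obtain ⟨ε, hε, hε1, hlt⟩ :=
    exists_mul_rpow_lt (2 * (2 * p ^ (1 / p)) ^ (m - 1) / V.toReal) hs1
  have hb := ofReal_le_of_map_mul e ((ae_nonneg_of_measure_Iio h2).and hle) hε1
  rw [Measure.map_apply hmeas measurableSet_Ioi] at hb
  have hb' := hb.trans (h3.measure_abs_gt_le hp i hε.le hε1)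
  rw [← hV, ← ENNReal.ofReal_toReal hVt,
    ← ENNReal.ofReal_div_of_pos (ENNReal.toReal_pos hV0 hVt),
    ENNReal.ofReal_le_ofReal_iff (by positivity)] at hb'
  have hr : (2 * (p * ε) ^ (1 / p)) ^ (m - 1) =
      (2 * p ^ (1 / p)) ^ (m - 1) * ε ^ (((m : ℝ) - 1) / p) := by
    rw [Real.mul_rpow hp0.le hε.le, ← mul_assoc, mul_pow, ← Real.rpow_mul_natCast hε.le,
      Nat.cast_sub (Nat.one_le_iff_ne_zero.2 hm), Nat.cast_one, one_div_mul_eq_div]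
  rw [hr] at hb'
  refine absurd hb' (not_le.2 (lt_of_eq_of_lt ?_ hlt))
  ring

end DimensionBound

/-! ### Generalized Gaussian and gamma laws, and the uniform marginal. -/

section Gamma

variable {p : ℝ}

/-- The density `exp (-|x| ^ p) / (2 Γ(1/p + 1))`. -/
noncomputable def genGaussianPDF (p x : ℝ) : ℝ≥0 :=
  Real.toNNReal (Real.exp (-|x| ^ p) / (2 * Real.Gamma (1 / p + 1)))

/-- The generalized Gaussian distribution, with density `exp (-|x| ^ p) / (2 Γ(1/p + 1))`. -/
noncomputable def genGaussian (p : ℝ) : Measure ℝ :=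
  volume.withDensity fun x => (genGaussianPDF p x : ℝ≥0∞)

theorem Gamma_one_div_add_one_pos (hp : 0 < p) : 0 < Real.Gamma (1 / p + 1) :=
  Real.Gamma_pos_of_pos (by positivity)

theorem measurable_genGaussianPDF (p : ℝ) : Measurable (genGaussianPDF p) := by
  unfold genGaussianPDF
  fun_prop

theorem coe_genGaussianPDF (hp : 0 < p) (x : ℝ) :
    (genGaussianPDF p x : ℝ) = Real.exp (-|x| ^ p) / (2 * Real.Gamma (1 / p + 1)) := by
  have := Gamma_one_div_add_one_pos hp
  exact Real.coe_toNNReal _ (by positivity)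

/-- The value is the transform of Gamma(`1 / p`): `|Z| ^ p` enters the proof through this formula
only. -/
theorem integral_exp_genGaussianPDF (hp : 0 < p) {t : ℝ} (ht : t < 1) :
    ∫ x, Real.exp (t * |x| ^ p) * genGaussianPDF p x = (1 - t) ^ (-1 / p) := by
  have hG := Gamma_one_div_add_one_pos hp
  have e : ∀ x : ℝ, Real.exp (t * |x| ^ p) * genGaussianPDF p x =
      Real.exp (-(1 - t) * |x| ^ p) / (2 * Real.Gamma (1 / p + 1)) := by
    intro x
    rw [coe_genGaussianPDF hp, ← mul_div_assoc, ← Real.exp_add]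
    ring_nf
  simp_rw [e]
  rw [integral_div, integral_comp_abs (f := fun y => Real.exp (-(1 - t) * y ^ p)),
    integral_exp_neg_mul_rpow hp (by linarith)]
  field_simp

theorem integral_exp_genGaussian (hp : 0 < p) {t : ℝ} (ht : t < 1) :
    ∫ x, Real.exp (t * |x| ^ p) ∂genGaussian p = (1 - t) ^ (-1 / p) := by
  rw [genGaussian, integral_withDensity_eq_integral_smul (measurable_genGaussianPDF p),
    ← integral_exp_genGaussianPDF hp ht]
  refine integral_congr_ae (Filter.Eventually.of_forall fun x => ?_)
  simp only [NNReal.smul_def, smul_eq_mul]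
  exact mul_comm _ _

theorem lintegral_exp_genGaussian (hp : 0 < p) {t : ℝ} (ht : t < 1) :
    ∫⁻ x, ENNReal.ofReal (Real.exp (t * |x| ^ p)) ∂genGaussian p =
      ENNReal.ofReal ((1 - t) ^ (-1 / p)) := by
  have h := integral_exp_genGaussian hp ht
  rw [← h, ofReal_integral_eq_lintegral_ofReal]
  · refine Integrable.of_integral_ne_zero ?_
    rw [h]
    exact (Real.rpow_pos_of_pos (by linarith) _).ne'
  · exact Filter.Eventually.of_forall fun x => (Real.exp_pos _).le

theorem isProbabilityMeasure_genGaussian (hp : 0 < p) : IsProbabilityMeasure (genGaussian p) := by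
  have h := lintegral_exp_genGaussian hp (t := 0) zero_lt_one
  exact ⟨by simpa using h⟩

theorem mgf_gammaMeasure {a : ℝ} (ha : 0 < a) {t : ℝ} (ht : t < 1) :
    mgf id (gammaMeasure a 1) t = (1 - t) ^ (-a) := by
  have hG := Real.Gamma_pos_of_pos ha
  have hm : Measurable fun x => Real.toNNReal (gammaPDFReal a 1 x) :=
    (measurable_gammaPDFReal a 1).real_toNNReal
  have h1 : mgf id (gammaMeasure a 1) t =
      ∫ x, Real.toNNReal (gammaPDFReal a 1 x) • Real.exp (t * x) := by
    rw [← integral_withDensity_eq_integral_smul hm]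
    rfl
  have h2 : ∀ x, Real.toNNReal (gammaPDFReal a 1 x) • Real.exp (t * x) =
      (Set.Ici (0 : ℝ)).indicator (fun x => (Real.Gamma a)⁻¹ *
        (x ^ (a - 1) * Real.exp (-((1 - t) * x)))) x := by
    intro x
    rw [NNReal.smul_def, Real.coe_toNNReal _ (gammaPDFReal_nonneg ha zero_lt_one x), smul_eq_mul,
      gammaPDFReal, Set.indicator_apply]
    simp only [Set.mem_Ici]
    split_ifs
    · rw [Real.one_rpow, mul_assoc, ← Real.exp_add, one_div, mul_assoc]
      ring_nf
    · rw [zero_mul]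
  rw [h1]
  simp_rw [h2]
  rw [integral_indicator measurableSet_Ici, integral_const_mul, integral_Ici_eq_integral_Ioi,
    Real.integral_rpow_mul_exp_neg_mul_Ioi ha (by linarith), one_div, Real.inv_rpow (by linarith),
    Real.rpow_neg (by linarith)]
  field_simp

/-- The point mass at 0 serves for `a = 0`, the boundary case `n = p + 1`. -/
theorem exists_mgf_eq_rpow {a : ℝ} (ha : 0 ≤ a) : ∃ ω : Measure ℝ, IsProbabilityMeasure ω ∧
    ∀ t < 1, mgf id ω t = (1 - t) ^ (-a) := by
  rcases ha.eq_or_lt with rfl | ha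
  · refine ⟨Measure.dirac 0, inferInstance, fun t _ => ?_⟩
    simp [mgf]
  · exact ⟨gammaMeasure a 1, isProbabilityMeasure_gammaMeasure ha zero_lt_one,
      fun t ht => mgf_gammaMeasure ha ht⟩

/-- Nonvanishing rules out the default value 0 of an undefined `mgf`. The complex transforms are
then analytic on `re z < c`, agree on real points accumulating at 0, hence on the imaginary axis,
where they are the characteristic functions. -/
theorem ext_of_mgf_eqOn {μ ν : Measure ℝ} [IsProbabilityMeasure μ] [IsProbabilityMeasure ν]
    {c : ℝ} (hc : 0 < c) (hμ : ∀ t < c, mgf id μ t ≠ 0) (h : ∀ t < c, mgf id μ t = mgf id ν t) :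
    μ = ν := by
  have hsub : ∀ ρ : Measure ℝ, (∀ t < c, mgf id ρ t ≠ 0) →
      AnalyticOnNhd ℂ (complexMGF id ρ) {z | z.re < c} := by
    intro ρ hρ
    refine analyticOnNhd_complexMGF.mono fun z hz => ?_
    have : Set.Iio c ⊆ interior (integrableExpSet id ρ) := by
      refine interior_maximal (fun t ht => ?_) isOpen_Iio
      by_contra hint
      exact hρ t ht (mgf_undef hint)
    exact this hz
  have hν : ∀ t < c, mgf id ν t ≠ 0 := fun t ht => h t ht ▸ hμ t ht
  have heq : Set.EqOn (complexMGF id μ) (complexMGF id ν) {z | z.re < c} := by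
    refine AnalyticOnNhd.eqOn_of_preconnected_of_frequently_eq (hsub μ hμ) (hsub ν hν)
      (convex_halfSpace_re_lt c).isPreconnected (z₀ := 0) (by simpa using hc) ?_
    rw [Filter.frequently_iff]
    intro U hU
    rw [mem_nhdsWithin] at hU
    obtain ⟨V, hV, h0, hVU⟩ := hU
    have hopen : IsOpen ((fun x : ℝ => (x : ℂ)) ⁻¹' V) := hV.preimage Complex.continuous_ofReal
    obtain ⟨δ, hδ, hball⟩ := Metric.isOpen_iff.1 hopen 0 (by simpa using h0)
    refine ⟨((-(δ / 2) : ℝ) : ℂ), hVU ⟨hball ?_, ?_⟩, ?_⟩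
    · rw [Metric.mem_ball, dist_zero_right, Real.norm_eq_abs, abs_neg, abs_of_pos (by linarith)]
      linarith
    · simpa using hδ.ne'
    · rw [complexMGF_ofReal, complexMGF_ofReal, h _ (by linarith)]
  refine Measure.ext_of_charFun (funext fun t => ?_)
  have := heq (x := t * Complex.I) (by simpa using hc)
  simp only [complexMGF, id] at this
  rw [charFun_apply_real, charFun_apply_real]
  convert this using 3 <;> ring_nf

theorem expMeasure_Ioi {x : ℝ} (hx : 0 ≤ x) :
    expMeasure 1 (Set.Ioi x) = ENNReal.ofReal (Real.exp (-x)) := by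
  have := isProbabilityMeasure_expMeasure zero_lt_one
  have h := cdf_expMeasure_eq zero_lt_one x
  rw [cdf_eq_real, if_pos hx, one_mul] at h
  rw [← Set.compl_Iic, ← ofReal_measureReal, probReal_compl_eq_one_sub measurableSet_Iic, h]
  ring_nf

theorem abs_div_rpow_lt_iff (hp : 0 < p) {z w a : ℝ} (hw : 0 < w) (ha : 0 < a) :
    |z / (|z| ^ p + w) ^ (1 / p)| < a ↔ (a ^ (-p) - 1) * |z| ^ p < w := by
  have hz : 0 ≤ |z| ^ p := by positivity
  have hs : 0 < (|z| ^ p + w) := by positivity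
  have hap : 0 < a ^ p := by positivity
  rw [abs_div, abs_of_pos (Real.rpow_pos_of_pos hs _), div_lt_iff₀ (by positivity),
    ← Real.rpow_lt_rpow_iff (abs_nonneg z) (by positivity) hp, Real.mul_rpow ha.le (by positivity),
    ← Real.rpow_mul hs.le, one_div_mul_cancel hp.ne', Real.rpow_one, Real.rpow_neg ha.le, sub_mul,
    one_mul, sub_lt_iff_lt_add, inv_mul_lt_iff₀ hap, add_comm w]

/-- For `0 < a < 1`, conditioning on `Z` turns the event `< a` into an exponential tail, and the
transform of `|Z| ^ p` at `1 - a ^ (-p)` gives `(a ^ (-p)) ^ (-1 / p) = a`. -/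
theorem map_genGaussian_exp_eq_unif (hp : 0 < p) :
    ((genGaussian p).prod (expMeasure 1)).map (fun q => |q.1 / (|q.1| ^ p + q.2) ^ (1 / p)|) =
      unif := by
  have := isProbabilityMeasure_genGaussian hp
  have := isProbabilityMeasure_expMeasure zero_lt_one
  have hm : Measurable fun q : ℝ × ℝ => |q.1 / (|q.1| ^ p + q.2) ^ (1 / p)| := by fun_prop
  have := Measure.isProbabilityMeasure_map
    (μ := (genGaussian p).prod (expMeasure 1)) hm.aemeasurable
  have hpos : ∀ᵐ q ∂(genGaussian p).prod (expMeasure 1), 0 < q.2 := by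
    have h0 : ∀ᵐ w ∂expMeasure 1, 0 < w := by
      have h1 := expMeasure_Ioi le_rfl
      rw [neg_zero, Real.exp_zero, ENNReal.ofReal_one] at h1
      exact (prob_compl_eq_zero_iff measurableSet_Ioi).2 h1
    rw [← (measurePreserving_snd (μ := genGaussian p) (ν := expMeasure 1)).map_eq] at h0
    exact ae_of_ae_map measurable_snd.aemeasurable h0
  have key : ∀ a : ℝ, ((genGaussian p).prod (expMeasure 1)).map
      (fun q => |q.1 / (|q.1| ^ p + q.2) ^ (1 / p)|) (Set.Iio a) = unif (Set.Iio a) := by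
    intro a
    rw [Measure.map_apply hm measurableSet_Iio, unif, Measure.restrict_apply measurableSet_Iio,
      Set.inter_comm, Set.Ioo_inter_Iio, Real.volume_Ioo, sub_zero]
    rcases le_or_gt a 0 with ha | ha
    · rw [min_eq_right (by linarith), ENNReal.ofReal_of_nonpos ha]
      convert measure_empty (μ := (genGaussian p).prod (expMeasure 1))
      ext q
      simpa using ha.trans (abs_nonneg _)
    have hae : (fun q : ℝ × ℝ => |q.1 / (|q.1| ^ p + q.2) ^ (1 / p)|) ⁻¹' Set.Iio a
        =ᵐ[(genGaussian p).prod (expMeasure 1)] {q | (a ^ (-p) - 1) * |q.1| ^ p < q.2} := by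
      filter_upwards [hpos] with q hq
      exact propext (abs_div_rpow_lt_iff hp hq ha)
    rw [measure_congr hae]
    rcases le_or_gt 1 a with ha1 | ha1
    · rw [min_eq_left ha1, ENNReal.ofReal_one]
      refine (prob_compl_eq_zero_iff (measurableSet_lt (by fun_prop) (by fun_prop))).1 ?_
      filter_upwards [hpos] with q hq
      refine lt_of_le_of_lt (mul_nonpos_of_nonpos_of_nonneg ?_ (by positivity)) hq
      rw [sub_nonpos]
      exact Real.rpow_le_one_of_one_le_of_nonpos ha1 (by linarith)
    · rw [min_eq_right ha1.le, Measure.prod_apply (measurableSet_lt (by fun_prop) (by fun_prop))]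
      have hc : 0 ≤ a ^ (-p) - 1 := by
        rw [sub_nonneg]
        exact Real.one_le_rpow_of_pos_of_le_one_of_nonpos ha ha1.le (by linarith)
      have e : ∀ z : ℝ, expMeasure 1 (Prod.mk z ⁻¹' {q | (a ^ (-p) - 1) * |q.1| ^ p < q.2}) =
          ENNReal.ofReal (Real.exp (-(a ^ (-p) - 1) * |z| ^ p)) := by
        intro z
        rw [neg_mul]
        exact expMeasure_Ioi (x := (a ^ (-p) - 1) * |z| ^ p) (mul_nonneg hc (by positivity))
      simp_rw [e]
      rw [lintegral_exp_genGaussian hp (by linarith), sub_neg_eq_add, add_sub_cancel,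
        ← Real.rpow_mul ha.le]
      congr 1
      rw [mul_div_assoc', neg_mul_neg, mul_one, div_self hp.ne', Real.rpow_one]
  refine Measure.ext_of_Ici _ _ fun a => ?_
  rw [← Set.compl_Iio, prob_compl_eq_one_sub measurableSet_Iio,
    prob_compl_eq_one_sub measurableSet_Iio, key]

end Gamma

/-! ### Construction of the copula for `n ≤ p + 1`, and its subvectors. -/

section Construction

variable {m n : ℕ} {p : ℝ}

theorem lintegral_pi_prod {m : ℕ} (μ : Fin m → Measure ℝ) [∀ i, SigmaFinite (μ i)]
    {f : Fin m → ℝ → ℝ≥0∞} (hf : ∀ i, Measurable (f i)) :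
    ∫⁻ x, ∏ i, f i (x i) ∂Measure.pi μ = ∏ i, ∫⁻ y, f i y ∂μ i := by
  induction m with
  | zero => simp
  | succ m ih =>
    have h := measurePreserving_piFinSuccAbove μ 0
    have hprod : Measurable fun x : Fin (m + 1) → ℝ => ∏ i, f i (x i) :=
      Finset.measurable_prod _ fun i _ => (hf i).comp (measurable_pi_apply i)
    rw [← h.symm.lintegral_comp hprod]
    simp_rw [Fin.prod_univ_succ, MeasurableEquiv.piFinSuccAbove_symm_apply, Fin.insertNthEquiv,
      Equiv.coe_fn_mk, Fin.insertNth_zero, Fin.cons_zero, Fin.cons_succ, Fin.zero_succAbove,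
      cast_eq]
    rw [lintegral_prod_mul (f := f 0) (g := fun x : Fin m → ℝ => ∏ i, f i.succ (x i))
      (hf 0).aemeasurable (Finset.measurable_prod _ fun i _ => (hf i.succ).comp
        (measurable_pi_apply i)).aemeasurable, ih (fun i => μ i.succ) fun i => hf i.succ]

/-- The radial density `r ↦ exp (-r ^ p) / (2 Γ(1/p + 1)) ^ m`. -/
noncomputable def radialGenGaussianPDF (m : ℕ) (p r : ℝ) : ℝ≥0 :=
  Real.toNNReal (Real.exp (-r ^ p) / (2 * Real.Gamma (1 / p + 1)) ^ m)

theorem measurable_radialGenGaussianPDF (m : ℕ) (p : ℝ) :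
    Measurable (radialGenGaussianPDF m p) := by
  unfold radialGenGaussianPDF
  fun_prop

theorem radialGenGaussianPDF_pNorm (hp : 0 < p) (x : Fin m → ℝ) :
    radialGenGaussianPDF m p (pNorm p x) = ∏ i, genGaussianPDF p (x i) := by
  have hG := Gamma_one_div_add_one_pos hp
  refine NNReal.coe_injective ?_
  rw [NNReal.coe_prod, radialGenGaussianPDF, Real.coe_toNNReal _ (by positivity), pNorm_rpow hp]
  simp_rw [coe_genGaussianPDF hp]
  rw [Finset.prod_div_distrib, Finset.prod_const, Finset.card_univ, Fintype.card_fin,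
    ← Real.exp_sum, Finset.sum_neg_distrib]

/-- The law of a vector with `m` independent generalized Gaussian coordinates. -/
noncomputable abbrev genGaussianPi (p : ℝ) (ι : Type*) [Fintype ι] : Measure (ι → ℝ) :=
  Measure.pi fun _ : ι => genGaussian p

theorem genGaussianPi_eq_radialMeasure (hp : 0 < p) (m : ℕ) :
    genGaussianPi p (Fin m) = radialMeasure m p (radialGenGaussianPDF m p) := by
  have := isProbabilityMeasure_genGaussian hp
  refine Measure.pi_eq fun s hs => ?_
  rw [radialMeasure, withDensity_apply _ (MeasurableSet.univ_pi hs), volume_pi,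
    Measure.restrict_pi_pi]
  simp_rw [radialGenGaussianPDF_pNorm hp, ENNReal.ofNNReal_finsetProd]
  rw [lintegral_pi_prod _ fun _ => (measurable_genGaussianPDF p).coe_nnreal_ennreal]
  refine Finset.prod_congr rfl fun i _ => ?_
  rw [genGaussian, withDensity_apply _ (hs i)]

/-- The map `(z, w) ↦ |z| / (‖z‖_p ^ p + w) ^ (1/p)`. -/
noncomputable def shrink (p : ℝ) (q : (Fin m → ℝ) × ℝ) : Fin m → ℝ :=
  fun i => |q.1 i / (pNorm p q.1 ^ p + q.2) ^ (1 / p)|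

theorem measurable_shrink (p : ℝ) : Measurable (shrink p : (Fin m → ℝ) × ℝ → Fin m → ℝ) := by
  have := measurable_pNorm (m := m) p
  unfold shrink
  fun_prop

/-- The vector factors as `R • U` with `U = Z / ‖Z‖_p` and `R` a function of `‖Z‖_p` and `W`, hence
independent of `U`. -/
theorem isPositiveLpSpherical_map_shrink (hp : 1 ≤ p) (hm : m ≠ 0) (ω : Measure ℝ)
    [IsProbabilityMeasure ω] :
    IsPositiveLpSpherical p (((genGaussianPi p (Fin m)).prod ω).map (shrink p)) := by
  have hp0 : 0 < p := zero_lt_one.trans_le hp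
  have := isProbabilityMeasure_genGaussian hp0
  have hN := measurable_pNorm (m := m) p
  have hD := measurable_direction (m := m) p
  have hg := measurable_radialGenGaussianPDF m p
  have hprob : IsProbabilityMeasure (radialMeasure m p (radialGenGaussianPDF m p)) := by
    rw [← genGaussianPi_eq_radialMeasure hp0]
    infer_instance
  rw [genGaussianPi_eq_radialMeasure hp0]
  set Γ := radialMeasure m p (radialGenGaussianPDF m p) with hΓ
  have hν : IsProbabilityMeasure (Γ.map (direction p)) :=
    Measure.isProbabilityMeasure_map hD.aemeasurable
  have hμN : IsProbabilityMeasure (Γ.map (pNorm p)) :=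
    Measure.isProbabilityMeasure_map hN.aemeasurable
  -- The absolute value keeps `R ≥ 0` even if `ω` charges negative numbers.
  let f : ℝ × ℝ → ℝ := fun q => |q.1 / (q.1 ^ p + q.2) ^ (1 / p)|
  have hf : Measurable f := by fun_prop
  have hρ : IsProbabilityMeasure (((Γ.map (pNorm p)).prod ω).map f) :=
    Measure.isProbabilityMeasure_map hf.aemeasurable
  have h1 : MeasurePreserving (fun x => (direction p x, pNorm p x)) Γ
      ((Γ.map (direction p)).prod (Γ.map (pNorm p))) :=
    ⟨hD.prodMk hN, map_direction_pNorm hp hm hg⟩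
  have h2 := (h1.prod (MeasurePreserving.id ω))
  have h3 := (measurePreserving_prodAssoc (Γ.map (direction p)) (Γ.map (pNorm p)) ω).comp h2
  have h4 := ((MeasurePreserving.id (Γ.map (direction p))).prod
    (hf.measurePreserving ((Γ.map (pNorm p)).prod ω))).comp h3
  have h5 := Measure.measurePreserving_swap.comp h4
  refine ⟨_, ⟨((Γ.map (pNorm p)).prod ω).map f, Γ.map (direction p), hρ, ?_,
    ⟨_, hg, hprob, rfl⟩, rfl⟩, ?_⟩
  · rw [Measure.map_apply hf measurableSet_Iio]
    convert measure_empty (μ := (Γ.map (pNorm p)).prod ω)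
    ext q
    simp [f]
  · rw [← h5.map_eq, Measure.map_map (by fun_prop) h5.measurable,
      Measure.map_map measurable_abs_pi ((by fun_prop : Measurable fun z : ℝ × (Fin m → ℝ) =>
        z.1 • z.2).comp h5.measurable)]
    congr 1
    ext q i
    have hz : q.1 i = pNorm p q.1 * direction p q.1 i :=
      (congrFun (pNorm_smul_direction hp0 q.1) i).symm
    simp only [shrink, Function.comp, Prod.map, Prod.swap, MeasurableEquiv.prodAssoc,
      MeasurableEquiv.coe_mk, Equiv.prodAssoc_apply, id, Pi.smul_apply, smul_eq_mul, f]
    rw [abs_mul, abs_abs, ← abs_mul, hz]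
    congr 1
    ring

/-- The sum of `w` and of the `|z j| ^ p` over the indices `j` outside the range of `e`. -/
noncomputable def remainder (p : ℝ) (e : Fin m → Fin n)
    (q : ({j // ¬ j ∈ Set.range e} → ℝ) × ℝ) : ℝ :=
  open Classical in ∑ j, |q.1 j| ^ p + q.2

open Classical in
theorem measurable_remainder (p : ℝ) (e : Fin m → Fin n) : Measurable (remainder p e) := by
  unfold remainder
  fun_prop

open Classical in
/-- The law of `remainder p e` for independent arguments. -/
noncomputable def remainderLaw (p : ℝ) (e : Fin m → Fin n) (ω : Measure ℝ) : Measure ℝ :=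
  ((genGaussianPi p {j // ¬ j ∈ Set.range e}).prod ω).map (remainder p e)

theorem isProbabilityMeasure_remainderLaw (hp : 0 < p) (e : Fin m → Fin n) (ω : Measure ℝ)
    [IsProbabilityMeasure ω] : IsProbabilityMeasure (remainderLaw p e ω) := by
  have := isProbabilityMeasure_genGaussian hp
  exact Measure.isProbabilityMeasure_map (measurable_remainder p e).aemeasurable

-- The omitted terms `|z j| ^ p` are independent of the retained coordinates and occur only in the
-- denominator, so they can be absorbed into `w`.
open Classical in
theorem map_shrink_comp (hp : 0 < p) {e : Fin m → Fin n} (he : Function.Injective e)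
    (ω : Measure ℝ) [IsProbabilityMeasure ω] :
    (((genGaussianPi p (Fin n)).prod ω).map (shrink p)).map (fun x => x ∘ e) =
      ((genGaussianPi p (Fin m)).prod (remainderLaw p e ω)).map (shrink p) := by
  have := isProbabilityMeasure_genGaussian hp
  have := isProbabilityMeasure_remainderLaw hp e ω
  let f : Fin m ≃ {j // j ∈ Set.range e} := Equiv.ofInjective e he
  have h0 : MeasurePreserving (MeasurableEquiv.piEquivPiSubtypeProd (fun _ : Fin n => ℝ)
      (fun j => j ∈ Set.range e)) (genGaussianPi p (Fin n))
      ((genGaussianPi p {j // j ∈ Set.range e}).prod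
        (genGaussianPi p {j // ¬ j ∈ Set.range e})) := by
    convert measurePreserving_piEquivPiSubtypeProd (fun _ : Fin n => genGaussian p)
      (fun j => j ∈ Set.range e)
  have h1 := h0.prod (MeasurePreserving.id ω)
  have h2 := (measurePreserving_prodAssoc (genGaussianPi p {j // j ∈ Set.range e})
    (genGaussianPi p {j // ¬ j ∈ Set.range e}) ω).comp h1
  have h3 := ((measurePreserving_piCongrLeft
    (fun _ : {j // j ∈ Set.range e} => genGaussian p) f).symm.prod
    ((measurable_remainder p e).measurePreserving
      ((genGaussianPi p {j // ¬ j ∈ Set.range e}).prod ω))).comp h2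
  have hcomp : Measurable fun x : Fin n → ℝ => x ∘ e :=
    measurable_pi_lambda _ fun i => measurable_pi_apply (e i)
  have h4 : ((genGaussianPi p (Fin m)).prod (remainderLaw p e ω)).map (shrink p) = _ :=
    congrArg (fun μ => μ.map (shrink p)) h3.map_eq.symm
  rw [h4, Measure.map_map hcomp (measurable_shrink p), Measure.map_map (measurable_shrink p)
    h3.measurable]
  congr 1
  ext q i
  have hsum : pNorm p q.1 ^ p = pNorm p (q.1 ∘ e) ^ p +
      ∑ j : {j // ¬ j ∈ Set.range e}, |q.1 j| ^ p := by
    rw [pNorm_rpow hp, pNorm_rpow hp, ← Fintype.sum_subtype_add_sum_subtype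
      (fun j => j ∈ Set.range e) (fun j => |q.1 j| ^ p)]
    congr 1
    convert (Equiv.sum_comp f (fun j : {j // j ∈ Set.range e} => |q.1 j| ^ p)).symm
    rfl
  change |q.1 (e i) / (pNorm p q.1 ^ p + q.2) ^ (1 / p)| =
    |q.1 (e i) / (pNorm p (q.1 ∘ e) ^ p + (∑ j : {j // ¬ j ∈ Set.range e}, |q.1 j| ^ p + q.2)) ^
      (1 / p)|
  rw [hsum, add_assoc]

open Classical in
theorem mgf_remainderLaw (hp : 0 < p) (e : Fin m → Fin n) (ω : Measure ℝ)
    [IsProbabilityMeasure ω] {t : ℝ} (ht : t < 1) :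
    mgf id (remainderLaw p e ω) t =
      ((1 - t) ^ (-1 / p)) ^ Fintype.card {j // ¬ j ∈ Set.range e} * mgf id ω t := by
  have := isProbabilityMeasure_genGaussian hp
  rw [remainderLaw, mgf_id_map (measurable_remainder p e).aemeasurable,
    ← integral_exp_genGaussian hp ht, ← integral_fintype_prod_eq_pow, mgf, mgf,
    ← integral_prod_mul]
  refine integral_congr_ae (Filter.Eventually.of_forall fun q => ?_)
  simp only [remainder, id]
  rw [← Real.exp_sum, ← Real.exp_add, ← Finset.mul_sum, mul_add]

/-- The parameter of `ω` is fixed by this count: `n - 1` omitted coordinates contribute `(n - 1) /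
p`, and the total must be 1, the exponential law. -/
theorem remainderLaw_const (hp : 0 < p) {ω : Measure ℝ} [IsProbabilityMeasure ω] (i : Fin n)
    (hω : ∀ t < 1, mgf id ω t = (1 - t) ^ (-(1 - ((n : ℝ) - 1) / p))) :
    remainderLaw p (fun _ : Fin 1 => i) ω = expMeasure 1 := by
  classical
  have := isProbabilityMeasure_remainderLaw hp (fun _ : Fin 1 => i) ω
  have := isProbabilityMeasure_expMeasure zero_lt_one
  have h1 : ∀ t < (1 : ℝ), mgf id (expMeasure 1) t = (1 - t) ^ (-1 : ℝ) := fun t ht =>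
    mgf_gammaMeasure zero_lt_one ht
  have h2 : ∀ t < (1 : ℝ), mgf id (remainderLaw p (fun _ : Fin 1 => i) ω) t =
      (1 - t) ^ (-1 : ℝ) := by
    intro t ht
    have ht' : 0 < 1 - t := by linarith
    have hc : Fintype.card {j // ¬ j ∈ Set.range fun _ : Fin 1 => i} = n - 1 := by
      rw [Fintype.card_subtype_compl]
      simp
    have hn : 1 ≤ n := Nat.one_le_iff_ne_zero.2 fun h => by subst h; exact i.elim0
    rw [mgf_remainderLaw hp _ _ ht, hc, hω t ht, ← Real.rpow_mul_natCast ht'.le,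
      ← Real.rpow_add ht', Nat.cast_sub hn]
    congr 1
    push_cast
    ring
  refine ext_of_mgf_eqOn zero_lt_one (fun t ht => ?_) fun t ht => (h2 t ht).trans (h1 t ht).symm
  rw [h2 t ht]
  exact (Real.rpow_pos_of_pos (by linarith) _).ne'

theorem map_eval_map_shrink (hp : 0 < p) {ω : Measure ℝ} [IsProbabilityMeasure ω] (i : Fin n)
    (hω : ∀ t < 1, mgf id ω t = (1 - t) ^ (-(1 - ((n : ℝ) - 1) / p))) :
    (((genGaussianPi p (Fin n)).prod ω).map (shrink p)).map (fun x => x i) = unif := by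
  have := isProbabilityMeasure_genGaussian hp
  have hE := isProbabilityMeasure_expMeasure zero_lt_one
  have h := map_shrink_comp hp (e := fun _ : Fin 1 => i)
    (Function.injective_of_subsingleton _) ω
  rw [remainderLaw_const hp i hω] at h
  have h' := congrArg (fun μ => μ.map fun x : Fin 1 → ℝ => x 0) h
  beta_reduce at h'
  have hcomp : Measurable fun (x : Fin n → ℝ) => x ∘ fun _ : Fin 1 => i :=
    measurable_pi_lambda _ fun _ => measurable_pi_apply i
  rw [Measure.map_map (by fun_prop) hcomp, Measure.map_map (by fun_prop) (measurable_shrink p)] at h'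
  rw [Measure.map_map (measurable_pi_apply i) (measurable_shrink p)]
  refine h'.trans ?_
  rw [← map_genGaussian_exp_eq_unif hp]
  have h1 : MeasurePreserving (MeasurableEquiv.funUnique (Fin 1) ℝ) (genGaussianPi p (Fin 1))
      (genGaussian p) := by
    convert measurePreserving_funUnique (genGaussian p) (Fin 1)
  have hu := h1.prod (MeasurePreserving.id (expMeasure 1))
  rw [← hu.map_eq, Measure.map_map (by fun_prop) hu.measurable,
    Measure.map_map (measurable_pi_apply 0) (measurable_shrink p)]
  refine Measure.map_congr (Filter.Eventually.of_forall fun q => ?_)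
  simp [shrink, pNorm_rpow hp]

theorem exists_isPositiveLpSphericalCopula (hp : 1 ≤ p) (hm : m ≠ 0) (hmn : m ≤ n)
    (hn : (n : ℝ) ≤ p + 1) : ∃ Q : Measure (Fin n → ℝ), IsProbabilityMeasure Q ∧
      IsPositiveLpSphericalCopula p Q ∧
      IsPositiveLpSphericalCopula p (Q.map fun x => x ∘ Fin.castLE hmn) := by
  have hp0 : 0 < p := zero_lt_one.trans_le hp
  have := isProbabilityMeasure_genGaussian hp0
  -- A gamma parameter must be nonnegative: this is where `n ≤ p + 1` is needed.
  have ha : 0 ≤ 1 - ((n : ℝ) - 1) / p := by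
    rw [sub_nonneg, div_le_one hp0]
    linarith
  obtain ⟨ω, hω, hmgf⟩ := exists_mgf_eq_rpow ha
  have hr := isProbabilityMeasure_remainderLaw hp0 (Fin.castLE hmn) ω
  refine ⟨((genGaussianPi p (Fin n)).prod ω).map (shrink p),
    Measure.isProbabilityMeasure_map (measurable_shrink p).aemeasurable,
    ⟨fun i => map_eval_map_shrink hp0 i hmgf, isPositiveLpSpherical_map_shrink hp (by lia) ω⟩,
    fun i => ?_, ?_⟩
  · rw [Measure.map_map (measurable_pi_apply i)
      (show Measurable fun x : Fin n → ℝ => x ∘ Fin.castLE hmn from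
        measurable_pi_lambda _ fun i => measurable_pi_apply (Fin.castLE hmn i))]
    exact map_eval_map_shrink hp0 (Fin.castLE hmn i) hmgf
  · rw [map_shrink_comp hp0 (Fin.castLE_injective hmn)]
    exact isPositiveLpSpherical_map_shrink hp hm _

end Construction

/-! ### Transfer to an extension of the given probability space. -/

section Extension

/-- If `X` has the same law as the image under `φ` of a vector of law `Q`, then some extension of
the probability space of `X` carries a vector `Y` of law `Q` with `φ ∘ Y = X` almost surely. -/
theorem exists_measurePreserving_map_eq {Ω : Type u} [MeasurableSpace Ω] {μ : Measure Ω}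
    [IsProbabilityMeasure μ] {n : ℕ} {E : Type*} [MeasurableSpace E] {X : Ω → E}
    (hX : Measurable X) {Q : Measure (Fin n → ℝ)} [IsProbabilityMeasure Q]
    {φ : (Fin n → ℝ) → E} (hφ : Measurable φ) (h : μ.map X = Q.map φ) :
    ∃ μ' : Measure (Ω × (Fin n → ℝ)), IsProbabilityMeasure μ' ∧
      MeasurePreserving Prod.fst μ' μ ∧
      μ'.map (fun z => (X z.1, z.2)) = Q.map fun x => (φ x, x) := by
  let ρ : Measure (E × (Fin n → ℝ)) := Q.map fun x => (φ x, x)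
  have hφid : Measurable fun x : Fin n → ℝ => (φ x, x) := hφ.prodMk measurable_id
  have hρ : IsProbabilityMeasure ρ := Measure.isProbabilityMeasure_map hφid.aemeasurable
  have hfst : ρ.fst = μ.map X := by
    rw [h, Measure.fst, Measure.map_map measurable_fst hφid]
    rfl
  -- Over each `ω` the new vector is drawn from the conditional law of `Q` given that `φ` takes the
  -- value `X ω`.
  refine ⟨μ ⊗ₘ (ρ.condKernel.comap X hX), inferInstance,
    ⟨measurable_fst, Measure.fst_compProd _ _⟩, ?_⟩
  refine Eq.trans ?_ (ρ.disintegrate ρ.condKernel)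
  rw [hfst]
  have hm : Measurable fun z : Ω × (Fin n → ℝ) => (X z.1, z.2) := by fun_prop
  have : IsProbabilityMeasure (μ.map X) := Measure.isProbabilityMeasure_map hX.aemeasurable
  ext s hs
  rw [Measure.map_apply hm hs, Measure.compProd_apply (hm hs), Measure.compProd_apply hs,
    lintegral_map (Kernel.measurable_kernel_prodMk_left hs) hX]
  rfl

end Extension

end LpSpherical

theorem mainTheorem7 {Ω : Type u} [MeasurableSpace Ω] (μ : Measure Ω)
    [IsProbabilityMeasure μ] (p : ℝ) (hp : 1 ≤ p) (d n : ℕ) (hd : 1 ≤ d) (hdn : d < n)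
    (X : Ω → Fin d → ℝ) (hX : Measurable X)
    (hcop : LpSpherical.IsPositiveLpSphericalCopula p (μ.map X)) :
    LpSpherical.ExtendsToLpSphericalCopula μ p X n hdn.le ↔ (n : ℝ) ≤ p + 1 := by
  constructor
  · rintro ⟨Ω', _, μ', π, Y, -, -, -, -, hY⟩
    exact hY.le_add_one hp (by lia)
  · intro hn
    obtain ⟨Q, hQ, hQn, hQd⟩ :=
      LpSpherical.exists_isPositiveLpSphericalCopula hp (by lia) hdn.le hn
    have hφ : Measurable fun x : Fin n → ℝ => x ∘ Fin.castLE hdn.le :=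
      measurable_pi_lambda _ fun i => measurable_pi_apply (Fin.castLE hdn.le i)
    obtain ⟨μ', hμ', hπ, hlaw⟩ := LpSpherical.exists_measurePreserving_map_eq hX hφ
      (hcop.unique hp (by lia) hQd)
    -- The coupling gives `φ ∘ Y = X` only almost surely. Overwriting the first `d` coordinates
    -- makes it hold everywhere without changing the law.
    let glue : (Fin d → ℝ) × (Fin n → ℝ) → Fin n → ℝ := fun q i =>
      if h : (i : ℕ) < d then q.1 ⟨i, h⟩ else q.2 i
    have hglue : Measurable glue := by
      refine measurable_pi_lambda _ fun i => ?_
      by_cases h : (i : ℕ) < d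
      · simp only [glue, h, dite_true]; fun_prop
      · simp only [glue, h, dite_false]; fun_prop
    have hm : Measurable fun z : Ω × (Fin n → ℝ) => (X z.1, z.2) := by fun_prop
    have hφid : Measurable fun x : Fin n → ℝ => (x ∘ Fin.castLE hdn.le, x) :=
      hφ.prodMk measurable_id
    refine ⟨Ω × (Fin n → ℝ), inferInstance, μ', Prod.fst, fun z => glue (X z.1, z.2), hμ', hπ,
      hglue.comp hm, fun z i => ?_, ?_⟩
    · simp [glue]
    · have e : μ'.map (fun z => glue (X z.1, z.2)) = Q := by
        have := congrArg (fun ρ => ρ.map glue) hlaw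
        beta_reduce at this
        rw [Measure.map_map hglue hm, Measure.map_map hglue hφid] at this
        refine this.trans ?_
        convert Measure.map_id (μ := Q)
        ext x i
        by_cases h : (i : ℕ) < d
        · simp [glue, h]
        · simp [glue, h]
      rw [e]
      exact hQn
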